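/- Let $F$ be a field and let $x_1,\dots,x_p$ be a basis of a $p$-dimensional vector space over $F$ (the $x_i$ are called parts). A $[t\times m,p]$ array code is a $t\times m$ array whose entries are linear combinations of $x_1,\dots,x_p$; its columns are called servers and the entries of a column are its cells. It has the $k$-PIR property if for every $i$ there are $k$ pairwise disjoint sets of columns such that $x_i$ lies in the linear span of the entries of the columns of each of these sets. The PIR rate of the code is $k/m$, where $k$ is the largest integer for which it has the $k$-PIR property. Let $s,t\ge 2$ be integers, $p=st$, and let $\eta_1,\dots,\eta_s$ be positive integers. Consider the array code with the following servers. For each of the $\binom{st}{t}$ sets of $t$ parts there are $\eta_1$ servers of Type $T_1$ whose $t$ cells contain these parts as singletons. For each $2\le r\le s$ and each pair of disjoint sets of parts $A,B$ with $|A|=t-1$, $|B|=(r-1)t+1$, there are $\eta_r$ servers of Type $T_r$ whose first $t-1$ cells contain the parts in $A$ as singletons and whose last cell contains $\sum_{x\in B}x$. For a part $x_i$ and $1\le r\le s-1$ let $G_r$ be the bipartite graph with first side the servers of Type $T_r$ in which $x_i$ is neither a singleton nor in the sum, second side the servers of Type $T_{r+1}$ in which $x_i$ occurs in the sum with other parts,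 and an edge between $v$ and $u$ if and only if the set of all $rt$ parts occurring in $v$ (as singletons or in the sum) equals the set of parts in the sum of $u$ other than $x_i$. Call $(\eta_1,\dots,\eta_s)$ admissible if for every part $x_i$ each of the graphs $G_1,\dots,G_{s-1}$ is regular. **Theorem.** For all integers $s,t>1$, admissible positive integers $\eta_1,\dots,\eta_s$ exist, and for every admissible choice the PIR rate of the above code is $$\frac{\beta+\gamma}{\beta+2\gamma},$$ where $$\beta=\prod_{\ell=1}^{s-1}(\ell t+1)+(t-1)\sum_{r=2}^{s}\frac{(s-1)!}{(s-r)!}\,t^{r-2}\prod_{\ell=r}^{s-1}(\ell t+1),\qquad \gamma=\sum_{r=1}^{s-1}\frac{(s-1)!}{(s-1-r)!}\,t^{r-1}\prod_{\ell=r}^{s-1}(\ell t+1).$$ Moreover, for fixed $s>1$, the rate of the code tends to $\frac{s+1}{2s}$ as $t\to\infty$. -/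

import Mathlib

open Filter Topology

/-- A `[t × m, p]` array code: a `t × m` array (the `m` columns, i.e. servers, are indexed by the
finite type `M`) whose entries are linear combinations of the standard basis
`x_i = Pi.single i 1` of the `p`-dimensional space `Fin p → F`. -/
abbrev ArrayCode (F : Type*) (t : ℕ) (M : Type*) (p : ℕ) : Type _ :=
  Fin t → M → (Fin p → F)

namespace ArrayCode

variable {F : Type*} [Field F] {t : ℕ} {M : Type*} {p : ℕ}

/-- The subspace spanned by the entries of the columns in `S`. -/
def columnSpan (A : ArrayCode F t M p) (S : Set M) : Submodule F (Fin p → F) :=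
  Submodule.span F {y | ∃ v ∈ S, ∃ c : Fin t, y = A c v}

/-- The `k`-PIR property: for each part `x_i` there are `k` pairwise disjoint sets of columns,
the entries of each of which span a subspace containing `x_i`. -/
def IsKPIR (A : ArrayCode F t M p) (k : ℕ) : Prop :=
  ∀ i : Fin p, ∃ S : Fin k → Set M,
    (∀ a b : Fin k, a ≠ b → Disjoint (S a) (S b)) ∧
    ∀ a : Fin k, (Pi.single i 1 : Fin p → F) ∈ A.columnSpan (S a)

/-- `ρ` is the PIR rate `k / m` of the array code, where `k` is the largest integer for which the
array code has the `k`-PIR property and `m` is its number of columns. -/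
def HasPIRRate [Fintype M] (A : ArrayCode F t M p) (ρ : ℝ) : Prop :=
  ∃ k : ℕ, IsGreatest {k' : ℕ | A.IsKPIR k'} k ∧ ρ = (k : ℝ) / (Fintype.card M : ℝ)

end ArrayCode

namespace GeneralConstruction

/-- A possible content `c = (singletons, parts of the sum)` of a server of Type `T_r`.
For `r = 1` the server has `t` singleton cells (its "sum" has only one part) and we record all of
them in `c.1`, with `c.2` empty.  For `r ≥ 2` it has `t - 1` singleton cells and one cell with the
sum of `(r - 1) t + 1` further parts. -/
def IsContent (s t r : ℕ) (c : Finset (Fin (s * t)) × Finset (Fin (s * t))) : Prop :=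
  Disjoint c.1 c.2 ∧
    if r = 1 then c.1.card = t ∧ c.2 = ∅
    else c.1.card = t - 1 ∧ c.2.card = (r - 1) * t + 1

/-- The servers: for each `r = 1, …, s`, every possible content of Type `T_r` is taken
`η r` times. -/
abbrev Server (s t : ℕ) (η : ℕ → ℕ) : Type :=
  Σ r : {r : ℕ // r ∈ Finset.Icc 1 s},
    {c : Finset (Fin (s * t)) × Finset (Fin (s * t)) // IsContent s t r.1 c} × Fin (η r.1)

namespace Server

variable {s t : ℕ} {η : ℕ → ℕ}

/-- The index `r` of the type `T_r` of a server. -/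
def type (v : Server s t η) : ℕ := v.1.1

/-- The set of singleton parts of a server. -/
def singles (v : Server s t η) : Finset (Fin (s * t)) := v.2.1.1.1

/-- The set of parts in the sum in the last cell of a server (empty for Type `T_1`). -/
def sumParts (v : Server s t η) : Finset (Fin (s * t)) := v.2.1.1.2

end Server

noncomputable instance instFintypeServer (s t : ℕ) (η : ℕ → ℕ) : Fintype (Server s t η) :=
  Fintype.ofFinite _

/-- The array code of the construction: the cells of a server hold its singletons, in increasing
order, and, for Types `T_r` with `r ≥ 2`, the last cell holds the sum. -/
def code (F : Type*) [Field F] (s t : ℕ) (η : ℕ → ℕ) :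
    ArrayCode F t (Server s t η) (s * t) :=
  fun j v =>
    if h : j.1 < v.singles.card then Pi.single (v.singles.orderEmbOfFin rfl ⟨j.1, h⟩) 1
    else ∑ b ∈ v.sumParts, Pi.single b 1

/-- First side of `G_r` for the part `x_i`: the servers of Type `T_r` in which `x_i` is neither a
singleton nor in the sum. -/
abbrev FirstSide (s t : ℕ) (η : ℕ → ℕ) (i : Fin (s * t)) (r : ℕ) : Type :=
  {v : Server s t η // v.type = r ∧ i ∉ v.singles ∧ i ∉ v.sumParts}

/-- Second side of `G_r` for the part `x_i`: the servers of Type `T_{r+1}` in which `x_i` is in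
the sum. -/
abbrev SecondSide (s t : ℕ) (η : ℕ → ℕ) (i : Fin (s * t)) (r : ℕ) : Type :=
  {u : Server s t η // u.type = r + 1 ∧ i ∈ u.sumParts}

/-- The bipartite graph `G_r` for the part `x_i`: `v` on the first side is adjacent to `u` on the
second side iff the parts occurring in `v` (singletons and sum) are exactly the parts other than
`x_i` of the sum of `u`. -/
def pairingGraph (s t : ℕ) (η : ℕ → ℕ) (i : Fin (s * t)) (r : ℕ) :
    SimpleGraph (FirstSide s t η i r ⊕ SecondSide s t η i r) where
  Adj a b :=
    match a, b with
    | Sum.inl v, Sum.inr u => v.1.singles ∪ v.1.sumParts = u.1.sumParts.erase i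
    | Sum.inr u, Sum.inl v => v.1.singles ∪ v.1.sumParts = u.1.sumParts.erase i
    | _, _ => False
  symm := ⟨by
    rintro (v | u) (v' | u') h <;> exact h⟩
  loopless := ⟨by rintro (v | u) h <;> exact h⟩

/-- Admissible multiplicities: all `η_r`, `1 ≤ r ≤ s`, are positive and, for every part `x_i`, the
bipartite graphs `G_1, …, G_{s-1}` are all regular. -/
def Admissible (s t : ℕ) (η : ℕ → ℕ) : Prop :=
  (∀ r ∈ Finset.Icc 1 s, 0 < η r) ∧
  ∀ i : Fin (s * t), ∀ r ∈ Finset.Icc 1 (s - 1), ∃ d : ℕ,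
    ∀ w, ((pairingGraph s t η i r).neighborSet w).ncard = d

/-- `β = ∏_{ℓ=1}^{s-1} (ℓ t + 1)
  + (t - 1) ∑_{r=2}^{s} (s-1)!/(s-r)! t^{r-2} ∏_{ℓ=r}^{s-1} (ℓ t + 1)`. -/
noncomputable def beta (s t : ℕ) : ℝ :=
  ∏ l ∈ Finset.Icc 1 (s - 1), ((l : ℝ) * t + 1) +
    ((t : ℝ) - 1) * ∑ r ∈ Finset.Icc 2 s,
      ((s - 1).factorial : ℝ) / ((s - r).factorial : ℝ) * (t : ℝ) ^ (r - 2) *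
        ∏ l ∈ Finset.Icc r (s - 1), ((l : ℝ) * t + 1)

/-- `γ = ∑_{r=1}^{s-1} (s-1)!/(s-1-r)! t^{r-1} ∏_{ℓ=r}^{s-1} (ℓ t + 1)`. -/
noncomputable def gamma (s t : ℕ) : ℝ :=
  ∑ r ∈ Finset.Icc 1 (s - 1),
    ((s - 1).factorial : ℝ) / ((s - 1 - r).factorial : ℝ) * (t : ℝ) ^ (r - 1) *
      ∏ l ∈ Finset.Icc r (s - 1), ((l : ℝ) * t + 1)

end GeneralConstruction

/-! ### Counting the contents of each type -/

namespace GeneralConstruction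

/-! Fix a part `x_i`. Let `a`, `b`, `c` count the servers in which it is a singleton, does not
occur, or lies in the sum. In any packing of `k` recovery sets, each set contains a server of the
first kind or has at least two servers: a lone server of another kind is killed by a functional that
is nonzero on `x_i` (`single_notMem_columnSpan`). Giving servers of the first kind weight 2 and the
others weight 1 yields `2k ≤ (a + b + c) + a`.

The bound is attained. Each component of `G_r` is complete bipartite, indexed by the set of `rt`
parts that `v` contains and that remain in the sum of `u` after removing `x_i`. Regularity equates
the sizes of its two sides (`admissible_iff`), so servers avoiding `x_i` are matched with those
having it in the sum, and a matched pair recovers `x_i`. Hence `b = c`, `k = a + b`, `m = a + 2b`.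

The ratio `a : b` is found from recurrences in `r`. Symmetry among the parts fixes how often `x_i`
is a singleton, in the sum, or absent in Type `T_{r+1}`, and admissibility links this to Type `T_r`.
The summands of `gamma` obey the same recurrence, so `a : b = beta : gamma`. After division by
`t^(s-1)`, both have binomial sums as limits, which gives the limit of the rate. -/

open Classical in
/-- The finite set of all contents of Type `T_r`. -/
noncomputable def contents (s t r : ℕ) : Finset (Finset (Fin (s * t)) × Finset (Fin (s * t))) :=
  Finset.univ.filter (IsContent s t r)

/-- The number of contents of Type `T_r` with a prescribed set of `r t` parts. -/
def splitCount (t r : ℕ) : ℕ := if r = 1 then 1 else (r * t).choose (t - 1)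

/-- The number of contents of Type `T_{r+1}` with a prescribed sum. -/
def extendCount (s t r : ℕ) : ℕ := (s * t - (r * t + 1)).choose (t - 1)

variable {s t r : ℕ} {η : ℕ → ℕ}

theorem mem_contents {c : Finset (Fin (s * t)) × Finset (Fin (s * t))} :
    c ∈ contents s t r ↔ IsContent s t r c := by
  simp [contents]

theorem isContent_one {c : Finset (Fin (s * t)) × Finset (Fin (s * t))} :
    IsContent s t 1 c ↔ c.1.card = t ∧ c.2 = ∅ := by
  simp only [IsContent, if_true]
  constructor
  · exact fun h => h.2
  · exact fun h => ⟨by simp [h.2], h⟩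

theorem isContent_succ (hr : 1 ≤ r) {c : Finset (Fin (s * t)) × Finset (Fin (s * t))} :
    IsContent s t (r + 1) c ↔
      Disjoint c.1 c.2 ∧ c.1.card = t - 1 ∧ c.2.card = r * t + 1 := by
  rw [IsContent, if_neg (by omega), Nat.add_sub_cancel]

theorem IsContent.card_union (ht : 1 ≤ t) (hr : 1 ≤ r)
    {c : Finset (Fin (s * t)) × Finset (Fin (s * t))} (h : IsContent s t r c) :
    (c.1 ∪ c.2).card = r * t := by
  rw [Finset.card_union_of_disjoint h.1]
  obtain ⟨q, rfl⟩ := Nat.exists_eq_add_of_le' hr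
  rcases Nat.eq_zero_or_pos q with rfl | hq
  · rw [isContent_one] at h
    simp [h.1, h.2]
  · rw [isContent_succ hq] at h
    rw [h.2.1, h.2.2, add_mul]
    omega

/-- For `r ≥ 2` a content is determined by its singletons, an arbitrary `(t - 1)`-subset of `U`; for
`r = 1` only `(U, ∅)` qualifies. -/
theorem card_contents_union_eq (ht : 1 ≤ t) (hr : 1 ≤ r) {U : Finset (Fin (s * t))}
    (hU : U.card = r * t) :
    ((contents s t r).filter fun c => c.1 ∪ c.2 = U).card = splitCount t r := by
  obtain ⟨q, rfl⟩ := Nat.exists_eq_add_of_le' hr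
  rcases Nat.eq_zero_or_pos q with rfl | hq
  · rw [splitCount, if_pos rfl, Finset.card_eq_one]
    refine ⟨(U, ∅), ?_⟩
    ext ⟨A, B⟩
    simp only [Finset.mem_filter, mem_contents, zero_add, isContent_one, Finset.mem_singleton,
      Prod.mk.injEq]
    constructor
    · rintro ⟨⟨_, rfl⟩, h⟩
      simpa using h
    · rintro ⟨rfl, rfl⟩
      simp [hU]
  · rw [splitCount, if_neg (by omega), ← hU, ← Finset.card_powersetCard]
    refine Finset.card_bij (fun c _ => c.1) ?_ ?_ ?_
    · rintro ⟨A, B⟩ h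
      simp only [Finset.mem_filter, mem_contents, isContent_succ hq] at h
      rw [Finset.mem_powersetCard]
      exact ⟨h.2 ▸ Finset.subset_union_left, h.1.2.1⟩
    · rintro ⟨A, B⟩ h ⟨A', B'⟩ h' e
      simp only [Finset.mem_filter, mem_contents, isContent_succ hq] at h h' e
      subst e
      have h1 : B = U \ A := by rw [← h.2, Finset.union_sdiff_cancel_left h.1.1]
      have h2 : B' = U \ A := by rw [← h'.2, Finset.union_sdiff_cancel_left h'.1.1]
      rw [h1, h2]
    · intro A hA
      rw [Finset.mem_powersetCard] at hA
      refine ⟨(A, U \ A), ?_, rfl⟩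
      simp only [Finset.mem_filter, mem_contents, isContent_succ hq]
      refine ⟨⟨Finset.disjoint_sdiff, hA.2, ?_⟩, Finset.union_sdiff_of_subset hA.1⟩
      rw [Finset.card_sdiff_of_subset hA.1, hA.2, hU, add_mul]
      omega

theorem card_contents_snd_eq (hr : 1 ≤ r) {W : Finset (Fin (s * t))} (hW : W.card = r * t + 1) :
    ((contents s t (r + 1)).filter fun c => c.2 = W).card = extendCount s t r := by
  have hc : Wᶜ.card = s * t - (r * t + 1) := by rw [Finset.card_compl, Fintype.card_fin, hW]
  rw [extendCount, ← hc, ← Finset.card_powersetCard]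
  refine Finset.card_bij (fun c _ => c.1) ?_ ?_ ?_
  · rintro ⟨A, B⟩ h
    simp only [Finset.mem_filter, mem_contents, isContent_succ hr] at h
    rw [Finset.mem_powersetCard, Finset.subset_compl_iff_disjoint_right, ← h.2]
    exact ⟨h.1.1, h.1.2.1⟩
  · rintro ⟨A, B⟩ h ⟨A', B'⟩ h' e
    simp only [Finset.mem_filter, mem_contents] at h h' e
    rw [e, h.2, h'.2]
  · intro A hA
    rw [Finset.mem_powersetCard, Finset.subset_compl_iff_disjoint_right] at hA
    exact ⟨(A, W), by simp [mem_contents, isContent_succ hr, hA.1, hA.2, hW], rfl⟩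

theorem card_contents_snd_eq_mem_fst (hr : 1 ≤ r) (i : Fin (s * t)) (ht : 2 ≤ t)
    {W : Finset (Fin (s * t))} (hW : W.card = r * t + 1) (hi : i ∉ W) :
    ((contents s t (r + 1)).filter fun c => i ∈ c.1 ∧ c.2 = W).card =
      (s * t - (r * t + 2)).choose (t - 2) := by
  have hc : (insert i W)ᶜ.card = s * t - (r * t + 2) := by
    rw [Finset.card_compl, Finset.card_insert_of_notMem hi, hW, Fintype.card_fin]
  rw [← hc, ← Finset.card_powersetCard]
  refine Finset.card_bij (fun c _ => c.1.erase i) ?_ ?_ ?_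
  · rintro ⟨A, B⟩ h
    simp only [Finset.mem_filter, mem_contents, isContent_succ hr] at h
    obtain ⟨⟨h1, h2, h3⟩, h4, rfl⟩ := h
    rw [Finset.mem_powersetCard, Finset.card_erase_of_mem h4, h2]
    refine ⟨fun x hx => ?_, by omega⟩
    rw [Finset.mem_erase] at hx
    simp only [Finset.mem_compl, Finset.mem_insert, not_or]
    exact ⟨hx.1, Finset.disjoint_left.1 h1 hx.2⟩
  · rintro ⟨A, B⟩ h ⟨A', B'⟩ h' e
    simp only [Finset.mem_filter, mem_contents] at h h' e
    rw [← Finset.insert_erase h.2.1, ← Finset.insert_erase h'.2.1, e, h.2.2, h'.2.2]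
  · intro A hA
    rw [Finset.mem_powersetCard] at hA
    have hiA : i ∉ A := fun h => by simpa using hA.1 h
    refine ⟨(insert i A, W), ?_, Finset.erase_insert hiA⟩
    simp only [Finset.mem_filter, mem_contents, isContent_succ hr, Finset.mem_insert_self,
      Finset.card_insert_of_notMem hiA, hA.2, hW, and_true, Finset.disjoint_insert_left]
    refine ⟨⟨hi, ?_⟩, by omega⟩
    exact Finset.disjoint_left.2 fun x hx hxW => by
      have := hA.1 hx
      simp [hxW] at this

theorem card_univ_erase (i : Fin (s * t)) : (Finset.univ.erase i).card = s * t - 1 := by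
  rw [Finset.card_erase_of_mem (Finset.mem_univ i), Finset.card_univ, Fintype.card_fin]

theorem _root_.Finset.card_eq_card_mul_of_fiberwise {α β : Type*} [DecidableEq β] {f : α → β}
    {S : Finset α} {T : Finset β} {m : ℕ} (H : ∀ a ∈ S, f a ∈ T)
    (hm : ∀ b ∈ T, (S.filter fun a => f a = b).card = m) : S.card = T.card * m := by
  rw [Finset.card_eq_sum_card_fiberwise (f := f) (t := T) fun a ha => H a ha,
    Finset.sum_const_nat hm]

theorem card_contents_notMem (ht : 1 ≤ t) (hr : 1 ≤ r) (i : Fin (s * t)) :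
    ((contents s t r).filter fun c => i ∉ c.1 ∧ i ∉ c.2).card =
      (s * t - 1).choose (r * t) * splitCount t r := by
  rw [← card_univ_erase i, ← Finset.card_powersetCard]
  refine Finset.card_eq_card_mul_of_fiberwise (f := fun c => c.1 ∪ c.2) ?_ ?_
  · intro c hc
    simp only [Finset.mem_filter, mem_contents] at hc
    rw [Finset.mem_powersetCard, hc.1.card_union ht hr, Finset.subset_erase]
    simp [hc.2]
  · intro U hU
    rw [Finset.mem_powersetCard, Finset.subset_erase] at hU
    rw [← card_contents_union_eq ht hr hU.2, Finset.filter_filter]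
    congr 1
    refine Finset.filter_congr fun c _ => and_iff_right_of_imp ?_
    rintro rfl
    simpa using hU.1.2

theorem card_contents_mem_snd (hr : 1 ≤ r) (i : Fin (s * t)) :
    ((contents s t (r + 1)).filter fun c => i ∈ c.2).card =
      (s * t - 1).choose (r * t) * extendCount s t r := by
  rw [← card_univ_erase i, ← Finset.card_powersetCard]
  refine Finset.card_eq_card_mul_of_fiberwise (f := fun c => c.2.erase i) ?_ ?_
  · intro c hc
    simp only [Finset.mem_filter, mem_contents, isContent_succ hr] at hc
    rw [Finset.mem_powersetCard, Finset.card_erase_of_mem hc.2, hc.1.2.2]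
    exact ⟨Finset.erase_subset_erase _ (Finset.subset_univ _), rfl⟩
  · intro U hU
    rw [Finset.mem_powersetCard, Finset.subset_erase] at hU
    have hW : (insert i U).card = r * t + 1 := by
      rw [Finset.card_insert_of_notMem hU.1.2, hU.2]
    rw [← card_contents_snd_eq hr hW, Finset.filter_filter]
    congr 1
    refine Finset.filter_congr fun c _ => ⟨?_, ?_⟩
    · rintro ⟨h, rfl⟩
      rw [Finset.insert_erase h]
    · rintro h
      rw [h]
      exact ⟨Finset.mem_insert_self _ _, Finset.erase_insert hU.1.2⟩

theorem card_contents_mem_fst (ht : 2 ≤ t) (hr : 1 ≤ r) (i : Fin (s * t)) :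
    ((contents s t (r + 1)).filter fun c => i ∈ c.1).card =
      (s * t - 1).choose (r * t + 1) * (s * t - (r * t + 2)).choose (t - 2) := by
  rw [← card_univ_erase i, ← Finset.card_powersetCard]
  refine Finset.card_eq_card_mul_of_fiberwise (f := fun c => c.2) ?_ ?_
  · intro c hc
    simp only [Finset.mem_filter, mem_contents, isContent_succ hr] at hc
    rw [Finset.mem_powersetCard, Finset.subset_erase]
    exact ⟨⟨Finset.subset_univ _, Finset.disjoint_left.1 hc.1.1 hc.2⟩, hc.1.2.2⟩
  · intro W hW
    rw [Finset.mem_powersetCard, Finset.subset_erase] at hW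
    rw [← card_contents_snd_eq_mem_fst hr i ht hW.2 hW.1.2, Finset.filter_filter]

theorem card_contents_one_mem_fst (ht : 1 ≤ t) (i : Fin (s * t)) :
    ((contents s t 1).filter fun c => i ∈ c.1).card = (s * t - 1).choose (t - 1) := by
  rw [← card_univ_erase i, ← Finset.card_powersetCard]
  refine Finset.card_bij (fun c _ => c.1.erase i) ?_ ?_ ?_
  · rintro ⟨A, B⟩ h
    simp only [Finset.mem_filter, mem_contents, isContent_one] at h
    rw [Finset.mem_powersetCard, Finset.card_erase_of_mem h.2, h.1.1]
    exact ⟨Finset.erase_subset_erase _ (Finset.subset_univ _), rfl⟩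
  · rintro ⟨A, B⟩ h ⟨A', B'⟩ h' e
    simp only [Finset.mem_filter, mem_contents, isContent_one] at h h' e
    rw [← Finset.insert_erase h.2, ← Finset.insert_erase h'.2, e, h.1.2, h'.1.2]
  · intro A hA
    rw [Finset.mem_powersetCard, Finset.subset_erase] at hA
    refine ⟨(insert i A, ∅), ?_, Finset.erase_insert hA.1.2⟩
    simp only [Finset.mem_filter, mem_contents, isContent_one, Finset.mem_insert_self,
      Finset.card_insert_of_notMem hA.1.2, hA.2, and_true]
    omega

theorem card_contents_one_mem_snd (i : Fin (s * t)) :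
    ((contents s t 1).filter fun c => i ∈ c.2).card = 0 := by
  rw [Finset.card_eq_zero, Finset.filter_eq_empty_iff]
  intro c hc
  rw [mem_contents, isContent_one] at hc
  simp [hc.2]

/-- Counting servers: each content of Type `T_r` occurs `η r` times. -/
theorem card_server
    (P : ℕ → Finset (Fin (s * t)) → Finset (Fin (s * t)) → Prop) [∀ r A B, Decidable (P r A B)] :
    Nat.card {v : Server s t η // P v.type v.singles v.sumParts} =
      ∑ r ∈ Finset.Icc 1 s, η r * ((contents s t r).filter fun c => P r c.1 c.2).card := by
  let e : {v : Server s t η // P v.type v.singles v.sumParts} ≃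
      Σ r : {r : ℕ // r ∈ Finset.Icc 1 s},
        {c : Finset (Fin (s * t)) × Finset (Fin (s * t)) //
          c ∈ (contents s t r.1).filter fun c => P r.1 c.1 c.2} × Fin (η r.1) :=
    { toFun := fun v => ⟨v.1.1, ⟨v.1.2.1.1, by
        rw [Finset.mem_filter, mem_contents]
        exact ⟨v.1.2.1.2, v.2⟩⟩, v.1.2.2⟩
      invFun := fun w => ⟨⟨w.1, ⟨w.2.1.1, mem_contents.1 (Finset.mem_filter.1 w.2.1.2).1⟩, w.2.2⟩,
        (Finset.mem_filter.1 w.2.1.2).2⟩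
      left_inv := fun _ => rfl
      right_inv := fun _ => rfl }
  rw [Nat.card_congr e, Nat.card_sigma]
  simp only [Nat.card_eq_fintype_card, Fintype.card_prod, Fintype.card_coe, Fintype.card_fin]
  rw [← Finset.sum_coe_sort (Finset.Icc 1 s)]
  exact Finset.sum_congr rfl fun r _ => mul_comm _ _

theorem card_server_of_type (hr : r ∈ Finset.Icc 1 s)
    (P : Finset (Fin (s * t)) → Finset (Fin (s * t)) → Prop) [∀ A B, Decidable (P A B)] :
    Nat.card {v : Server s t η // v.type = r ∧ P v.singles v.sumParts} =
      η r * ((contents s t r).filter fun c => P c.1 c.2).card := by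
  rw [card_server fun q A B => q = r ∧ P A B, Finset.sum_eq_single_of_mem r hr]
  · simp
  · intro q _ hq
    simp [hq]

end GeneralConstruction

/-! ### Degrees in the graphs and admissibility -/

namespace GeneralConstruction

variable {s t r : ℕ} {η : ℕ → ℕ}

namespace Server

/-- The set of all parts occurring in a server. -/
def parts (v : Server s t η) : Finset (Fin (s * t)) := v.singles ∪ v.sumParts

theorem type_mem (v : Server s t η) : v.type ∈ Finset.Icc 1 s := v.1.2

theorem one_le_type (v : Server s t η) : 1 ≤ v.type := (Finset.mem_Icc.1 v.type_mem).1

theorem isContent (v : Server s t η) : IsContent s t v.type (v.singles, v.sumParts) := v.2.1.2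

theorem disjoint (v : Server s t η) : Disjoint v.singles v.sumParts := v.isContent.1

theorem card_parts (ht : 1 ≤ t) (v : Server s t η) : v.parts.card = v.type * t :=
  v.isContent.card_union ht v.one_le_type

theorem card_sumParts (v : Server s t η) (h : v.sumParts.Nonempty) :
    2 ≤ v.type ∧ v.sumParts.card = (v.type - 1) * t + 1 := by
  have hv := v.isContent
  have h1 := v.one_le_type
  by_cases h2 : v.type = 1
  · rw [h2, isContent_one] at hv
    have h2 : v.sumParts = ∅ := hv.2
    simp [h2] at h
  · rw [IsContent, if_neg h2] at hv
    exact ⟨by omega, hv.2.2⟩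

theorem notMem_parts {v : Server s t η} {i : Fin (s * t)} :
    i ∉ v.parts ↔ i ∉ v.singles ∧ i ∉ v.sumParts := by
  simp [parts]

/-- A server in which some part does not occur is not of the last type. -/
theorem type_lt_of_notMem_parts (ht : 1 ≤ t) {v : Server s t η} {i : Fin (s * t)}
    (h : i ∉ v.parts) : v.type < s := by
  have h1 := Finset.card_lt_univ_of_notMem h
  rw [Fintype.card_fin, v.card_parts ht] at h1
  exact lt_of_mul_lt_mul_right h1 (Nat.zero_le t)

/-- The type need not be prescribed, since it can be read off from the number of parts. These counts
and those of `card_sumParts_eq` are the vertex degrees in `G_r`. -/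
theorem card_parts_eq (ht : 1 ≤ t) (hr : r ∈ Finset.Icc 1 s) {U : Finset (Fin (s * t))}
    (hU : U.card = r * t) :
    Nat.card {v : Server s t η // v.parts = U} = η r * splitCount t r := by
  rw [← card_contents_union_eq ht (Finset.mem_Icc.1 hr).1 hU,
    ← card_server_of_type hr fun A B => A ∪ B = U]
  refine Nat.card_congr (Equiv.subtypeEquivRight fun v => (and_iff_right_of_imp ?_).symm)
  intro h
  have h1 : v.type * t = r * t := by rw [← v.card_parts ht, ← hU, ← h, parts]
  exact Nat.eq_of_mul_eq_mul_right ht h1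

theorem card_sumParts_eq (ht : 1 ≤ t) (hr : r ∈ Finset.Icc 1 (s - 1)) {W : Finset (Fin (s * t))}
    (hW : W.card = r * t + 1) :
    Nat.card {u : Server s t η // u.sumParts = W} = η (r + 1) * extendCount s t r := by
  rw [Finset.mem_Icc] at hr
  rw [← card_contents_snd_eq hr.1 hW,
    ← card_server_of_type (Finset.mem_Icc.2 ⟨by omega, by omega⟩) fun A B => B = W]
  refine Nat.card_congr (Equiv.subtypeEquivRight fun v => (and_iff_right_of_imp ?_).symm)
  rintro rfl
  have h2 := v.card_sumParts (Finset.card_pos.1 (by omega))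
  have h1 : (v.type - 1) * t = r * t := by omega
  have := Nat.eq_of_mul_eq_mul_right ht h1
  omega

end Server

theorem ncard_neighborSet_inl (ht : 1 ≤ t) (hr : r ∈ Finset.Icc 1 (s - 1)) (i : Fin (s * t))
    (v : FirstSide s t η i r) :
    ((pairingGraph s t η i r).neighborSet (Sum.inl v)).ncard = η (r + 1) * extendCount s t r := by
  have hi : i ∉ v.1.parts := Server.notMem_parts.2 v.2.2
  have hW : (insert i v.1.parts).card = r * t + 1 := by
    rw [Finset.card_insert_of_notMem hi, v.1.card_parts ht, v.2.1]
  rw [← Server.card_sumParts_eq ht hr hW]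
  symm
  have key (u : {u : Server s t η // u.sumParts = insert i v.1.parts}) :
      u.1.type = r + 1 ∧ i ∈ u.1.sumParts := by
    refine ⟨?_, by simp [u.2]⟩
    have h2 := u.1.card_sumParts (by simp [u.2])
    rw [u.2, hW] at h2
    have h1 : (u.1.type - 1) * t = r * t := by omega
    have := Nat.eq_of_mul_eq_mul_right ht h1
    omega
  refine Nat.card_congr
    { toFun := fun u => ⟨Sum.inr ⟨u.1, key u⟩, ?_⟩
      invFun := fun
        | ⟨Sum.inr u, hu⟩ => ⟨u.1, ?_⟩
        | ⟨Sum.inl u, hu⟩ => False.elim hu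
      left_inv := fun _ => rfl
      right_inv := ?_ }
  · change v.1.parts = u.1.sumParts.erase i
    rw [u.2, Finset.erase_insert hi]
  · change v.1.parts = u.1.sumParts.erase i at hu
    rw [hu, Finset.insert_erase u.2.2]
  · rintro ⟨u | u, hu⟩
    · exact False.elim hu
    · rfl

theorem ncard_neighborSet_inr (ht : 1 ≤ t) (hr : r ∈ Finset.Icc 1 (s - 1)) (i : Fin (s * t))
    (u : SecondSide s t η i r) :
    ((pairingGraph s t η i r).neighborSet (Sum.inr u)).ncard = η r * splitCount t r := by
  have hr' := Finset.mem_Icc.1 hr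
  have hU : (u.1.sumParts.erase i).card = r * t := by
    rw [Finset.card_erase_of_mem u.2.2, (u.1.card_sumParts ⟨i, u.2.2⟩).2, u.2.1]
    rfl
  rw [← Server.card_parts_eq ht (Finset.mem_Icc.2 ⟨hr'.1, by omega⟩) hU]
  symm
  have key (v : {v : Server s t η // v.parts = u.1.sumParts.erase i}) :
      v.1.type = r ∧ i ∉ v.1.singles ∧ i ∉ v.1.sumParts := by
    refine ⟨?_, Server.notMem_parts.1 (by simp [v.2])⟩
    have h1 : v.1.type * t = r * t := by rw [← v.1.card_parts ht, v.2, hU]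
    exact Nat.eq_of_mul_eq_mul_right ht h1
  exact Nat.card_congr
    { toFun := fun v => ⟨Sum.inl ⟨v.1, key v⟩, v.2⟩
      invFun := fun
        | ⟨Sum.inl v, hv⟩ => ⟨v.1, hv⟩
        | ⟨Sum.inr v, hv⟩ => False.elim hv
      left_inv := fun _ => rfl
      right_inv := by
        rintro ⟨v | v, hv⟩
        · rfl
        · exact False.elim hv }

theorem card_firstSide (ht : 1 ≤ t) (hr : r ∈ Finset.Icc 1 s) (i : Fin (s * t)) :
    Nat.card (FirstSide s t η i r) = η r * ((s * t - 1).choose (r * t) * splitCount t r) := by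
  rw [← card_contents_notMem ht (Finset.mem_Icc.1 hr).1 i]
  exact card_server_of_type hr fun A B => i ∉ A ∧ i ∉ B

theorem card_secondSide (hr : r ∈ Finset.Icc 1 (s - 1)) (i : Fin (s * t)) :
    Nat.card (SecondSide s t η i r) =
      η (r + 1) * ((s * t - 1).choose (r * t) * extendCount s t r) := by
  rw [Finset.mem_Icc] at hr
  rw [← card_contents_mem_snd hr.1 i]
  exact card_server_of_type (Finset.mem_Icc.2 ⟨by omega, by omega⟩) fun A B => i ∈ B

theorem splitCount_pos (hr : 1 ≤ r) : 0 < splitCount t r := by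
  unfold splitCount
  split_ifs
  · exact one_pos
  · exact Nat.choose_pos ((Nat.sub_le t 1).trans (Nat.le_mul_of_pos_left t hr))

theorem mul_add_le (hr : r ∈ Finset.Icc 1 (s - 1)) : r * t + t ≤ s * t := by
  rw [Finset.mem_Icc] at hr
  rw [← Nat.succ_mul]
  exact Nat.mul_le_mul_right t (by omega)

theorem extendCount_pos (ht : 1 ≤ t) (hr : r ∈ Finset.Icc 1 (s - 1)) :
    0 < extendCount s t r := by
  have := mul_add_le (t := t) hr
  exact Nat.choose_pos (by omega)

/-- Regularity of the graphs `G_r` as a relation between the multiplicities. -/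
theorem admissible_iff (ht : 1 ≤ t) :
    Admissible s t η ↔ (∀ r ∈ Finset.Icc 1 s, 0 < η r) ∧
      ∀ r ∈ Finset.Icc 1 (s - 1), η r * splitCount t r = η (r + 1) * extendCount s t r := by
  refine and_congr_right fun hpos => ⟨fun h r hr => ?_, fun h i r hr => ?_⟩
  · have hr' := Finset.mem_Icc.1 hr
    have hle := mul_add_le (t := t) hr
    -- Both sides of the graph are shown nonempty for this part, so that regularity really equates
    -- the two degrees.
    let i : Fin (s * t) := ⟨0, by omega⟩
    have hrs : r ∈ Finset.Icc 1 s := Finset.mem_Icc.2 ⟨hr'.1, by omega⟩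
    have hrs' : r + 1 ∈ Finset.Icc 1 s := Finset.mem_Icc.2 ⟨by omega, by omega⟩
    have hchoose : 0 < (s * t - 1).choose (r * t) := Nat.choose_pos (by omega)
    have hX : 0 < Nat.card (FirstSide s t η i r) := by
      rw [card_firstSide ht hrs]
      exact Nat.mul_pos (hpos r hrs) (Nat.mul_pos hchoose (splitCount_pos hr'.1))
    have hY : 0 < Nat.card (SecondSide s t η i r) := by
      rw [card_secondSide hr]
      exact Nat.mul_pos (hpos _ hrs') (Nat.mul_pos hchoose (extendCount_pos ht hr))
    obtain ⟨v⟩ := (Nat.card_pos_iff.1 hX).1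
    obtain ⟨u⟩ := (Nat.card_pos_iff.1 hY).1
    obtain ⟨d, hd⟩ := h i r hr
    rw [← ncard_neighborSet_inl ht hr i v, ← ncard_neighborSet_inr ht hr i u, hd, hd]
  · refine ⟨η r * splitCount t r, ?_⟩
    rintro (v | u)
    · rw [ncard_neighborSet_inl ht hr, h r hr]
    · rw [ncard_neighborSet_inr ht hr]

theorem exists_admissible (ht : 1 ≤ t) : ∃ η : ℕ → ℕ, Admissible s t η := by
  -- Passing from `r` to `r + 1` trades the factor `extendCount s t r` for `splitCount t r`, as the
  -- degree equation requires.
  refine ⟨fun r => (∏ l ∈ Finset.Ico 1 r, splitCount t l) * ∏ l ∈ Finset.Ico r s, extendCount s t l,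
    (admissible_iff ht).2 ⟨fun r hr => ?_, fun r hr => ?_⟩⟩
  · rw [Finset.mem_Icc] at hr
    refine Nat.mul_pos (Finset.prod_pos fun l hl => ?_) (Finset.prod_pos fun l hl => ?_)
    · exact splitCount_pos (Finset.mem_Ico.1 hl).1
    · rw [Finset.mem_Ico] at hl
      exact extendCount_pos ht (Finset.mem_Icc.2 ⟨by omega, by omega⟩)
  · rw [Finset.mem_Icc] at hr
    rw [Finset.prod_Ico_succ_top hr.1, Finset.prod_eq_prod_Ico_succ_bot (show r < s by omega)]
    ring

theorem _root_.Finset.sum_Icc_one_eq_add {M : Type*} [AddCommMonoid M] (f : ℕ → M) (hs : 1 ≤ s) :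
    ∑ r ∈ Finset.Icc 1 s, f r = f 1 + ∑ r ∈ Finset.Icc 1 (s - 1), f (r + 1) := by
  induction s, hs using Nat.le_induction with
  | base => simp
  | succ q hq ih =>
    rw [Finset.sum_Icc_succ_top (by omega), ih, add_assoc, Nat.add_sub_cancel]
    congr 1
    obtain ⟨p, rfl⟩ := Nat.exists_eq_add_of_le' hq
    rw [Finset.sum_Icc_succ_top (by omega), Nat.add_sub_cancel]

/-! ### Server counts and their proportionality to `beta` and `gamma` -/

/-- Number of servers with a given part as a singleton. -/
theorem card_mem_singles (hs : 1 ≤ s) (ht : 2 ≤ t) (i : Fin (s * t)) :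
    Nat.card {v : Server s t η // i ∈ v.singles} =
      η 1 * (s * t - 1).choose (t - 1) + ∑ r ∈ Finset.Icc 1 (s - 1),
        η (r + 1) * ((s * t - 1).choose (r * t + 1) * (s * t - (r * t + 2)).choose (t - 2)) := by
  rw [card_server fun _ A _ => i ∈ A, Finset.sum_Icc_one_eq_add _ hs]
  congr 1
  · rw [← card_contents_one_mem_fst (by omega) i]
  · refine Finset.sum_congr rfl fun r hr => ?_
    rw [← card_contents_mem_fst ht (Finset.mem_Icc.1 hr).1 i]

/-- Number of servers in which a given part does not occur. -/
theorem card_notMem_parts (hs : 1 ≤ s) (ht : 1 ≤ t) (i : Fin (s * t)) :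
    Nat.card {v : Server s t η // i ∉ v.singles ∧ i ∉ v.sumParts} =
      ∑ r ∈ Finset.Icc 1 (s - 1), η r * ((s * t - 1).choose (r * t) * splitCount t r) := by
  rw [card_server fun _ A B => i ∉ A ∧ i ∉ B]
  obtain ⟨q, rfl⟩ := Nat.exists_eq_add_of_le' hs
  have hpos : 0 < (q + 1) * t := Nat.mul_pos (by omega) ht
  -- A server of the last type contains every part, so the top term vanishes.
  rw [Finset.sum_Icc_succ_top (by omega), card_contents_notMem ht (by omega),
    Nat.choose_eq_zero_of_lt (by omega), zero_mul, mul_zero, add_zero]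
  refine Finset.sum_congr rfl fun r hr => ?_
  rw [← card_contents_notMem ht (Finset.mem_Icc.1 hr).1 i]

/-- Number of servers with a given part in the sum. -/
theorem card_mem_sumParts (hs : 1 ≤ s) (i : Fin (s * t)) :
    Nat.card {v : Server s t η // i ∈ v.sumParts} =
      ∑ r ∈ Finset.Icc 1 (s - 1),
        η (r + 1) * ((s * t - 1).choose (r * t) * extendCount s t r) := by
  rw [card_server fun _ _ B => i ∈ B, Finset.sum_Icc_one_eq_add _ hs]
  rw [card_contents_one_mem_snd i, mul_zero, zero_add]
  refine Finset.sum_congr rfl fun r hr => ?_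
  rw [← card_contents_mem_snd (Finset.mem_Icc.1 hr).1 i]

/-- The number of servers of Type `T_r` in which a given part does not occur. -/
def avoidCount (s t : ℕ) (η : ℕ → ℕ) (r : ℕ) : ℕ :=
  η r * ((s * t - 1).choose (r * t) * splitCount t r)

/-- The number of servers of Type `T_{r+1}` with a given part as a singleton. -/
def singleCount (s t : ℕ) (η : ℕ → ℕ) (r : ℕ) : ℕ :=
  η (r + 1) * ((s * t - 1).choose (r * t + 1) * (s * t - (r * t + 2)).choose (t - 2))

/-- The two sides of a regular bipartite graph have equal size: the right-hand side counts the Type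
`T_{r+1}` servers with the part in the sum. -/
theorem Admissible.avoidCount_eq (ht : 1 ≤ t) (h : Admissible s t η)
    (hr : r ∈ Finset.Icc 1 (s - 1)) :
    avoidCount s t η r = η (r + 1) * ((s * t - 1).choose (r * t) * extendCount s t r) := by
  rw [avoidCount, mul_left_comm, ((admissible_iff ht).1 h).2 r hr]
  ring

theorem Admissible.avoidCount_one_pos (hs : 1 < s) (h : Admissible s t η) :
    0 < avoidCount s t η 1 := by
  have h1 : 1 * t + t ≤ s * t := mul_add_le (Finset.mem_Icc.2 ⟨le_rfl, by omega⟩)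
  exact Nat.mul_pos (h.1 1 (Finset.mem_Icc.2 ⟨le_rfl, hs.le⟩))
    (Nat.mul_pos (Nat.choose_pos (by omega)) (splitCount_pos le_rfl))

theorem choose_pred_mul (ht : 1 ≤ t) :
    (s * t - 1).choose (t - 1) * (s - 1) = (s * t - 1).choose t := by
  have h := Nat.choose_succ_right_eq (s * t - 1) (t - 1)
  rw [Nat.sub_add_cancel ht, show s * t - 1 - (t - 1) = (s - 1) * t by
    rw [Nat.sub_mul, one_mul]; omega, ← mul_assoc] at h
  exact (Nat.eq_of_mul_eq_mul_right ht h).symm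

/-- A Type `T_{r+1}` server has `t - 1` singletons and `rt + 1` parts in its sum. By symmetry a
fixed part plays these roles in that ratio, and the second role occurs `avoidCount s t η r` times.
The proof checks this through binomial identities. -/
theorem Admissible.singleCount_mul (ht : 2 ≤ t) (h : Admissible s t η)
    (hr : r ∈ Finset.Icc 1 (s - 1)) :
    singleCount s t η r * (r * t + 1) = avoidCount s t η r * (t - 1) := by
  have hle := mul_add_le (t := t) hr
  rw [h.avoidCount_eq (by omega) hr, singleCount, extendCount]
  have h1 := Nat.choose_succ_right_eq (s * t - 1) (r * t)
  have h2 := Nat.add_one_mul_choose_eq (s * t - (r * t + 2)) (t - 2)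
  rw [show s * t - (r * t + 2) + 1 = s * t - (r * t + 1) by omega,
    show t - 2 + 1 = t - 1 by omega] at h2
  rw [show s * t - 1 - r * t = s * t - (r * t + 1) by omega] at h1
  calc _ = η (r + 1) * (((s * t - 1).choose (r * t + 1) * (r * t + 1)) *
        (s * t - (r * t + 2)).choose (t - 2)) := by ring
    _ = η (r + 1) * ((s * t - 1).choose (r * t) *
        ((s * t - (r * t + 1)) * (s * t - (r * t + 2)).choose (t - 2))) := by rw [h1]; ring
    _ = _ := by rw [h2]; ring

/-- A Type `T_{r+1}` server omits `(s - 1 - r)t` parts and has `rt + 1` in its sum, so by symmetry a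
fixed part is absent or in the sum in that ratio. -/
theorem Admissible.avoidCount_succ_mul (ht : 1 ≤ t) (h : Admissible s t η)
    (hr : r ∈ Finset.Icc 1 (s - 1)) :
    avoidCount s t η (r + 1) * (r * t + 1) = avoidCount s t η r * ((s - 1 - r) * t) := by
  have hle := mul_add_le (t := t) hr
  have hr' := Finset.mem_Icc.1 hr
  rw [h.avoidCount_eq ht hr, avoidCount, extendCount, splitCount, if_neg (by omega)]
  have h1 := Nat.choose_succ_right_eq (s * t - (r * t + 1)) (t - 1)
  have h2 := Nat.choose_succ_right_eq ((r + 1) * t) (t - 1)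
  have hK : (r + 1) * t = r * t + t := Nat.succ_mul r t
  have hS : (s - 1 - r) * t = s * t - t - r * t := by rw [Nat.sub_mul, Nat.sub_mul, one_mul]
  have h3 := Nat.choose_mul (n := s * t - 1) (k := (r + 1) * t) (s := r * t) (by omega)
  rw [show (r + 1) * t - r * t = t by omega, show s * t - 1 - r * t = s * t - (r * t + 1) by omega,
    ← Nat.choose_symm (show r * t ≤ (r + 1) * t by omega),
    show (r + 1) * t - r * t = t by omega] at h3
  rw [Nat.sub_add_cancel ht, show s * t - (r * t + 1) - (t - 1) = (s - 1 - r) * t by omega] at h1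
  rw [Nat.sub_add_cancel ht, show (r + 1) * t - (t - 1) = r * t + 1 by omega] at h2
  calc _ = η (r + 1) * ((s * t - 1).choose ((r + 1) * t) *
        (((r + 1) * t).choose (t - 1) * (r * t + 1))) := by ring
    _ = η (r + 1) * ((s * t - 1).choose ((r + 1) * t) * ((r + 1) * t).choose t * t) := by
        rw [← h2]; ring
    _ = η (r + 1) * ((s * t - 1).choose (r * t) *
        ((s * t - (r * t + 1)).choose t * t)) := by rw [h3]; ring
    _ = _ := by rw [h1]; ring

/-- The summands of `gamma`. -/
noncomputable def gammaTerm (s t r : ℕ) : ℝ :=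
  ((s - 1).factorial : ℝ) / ((s - 1 - r).factorial : ℝ) * (t : ℝ) ^ (r - 1) *
    ∏ l ∈ Finset.Icc r (s - 1), ((l : ℝ) * t + 1)

/-- This is the recurrence of `avoidCount_succ_mul`; it makes the two sequences proportional. -/
theorem gammaTerm_succ_mul (hr : r ∈ Finset.Icc 1 (s - 2)) :
    gammaTerm s t (r + 1) * (r * t + 1) = gammaTerm s t r * ((s - 1 - r : ℕ) * t) := by
  rw [Finset.mem_Icc] at hr
  have hprod : ∏ l ∈ Finset.Icc r (s - 1), ((l : ℝ) * t + 1) =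
      ((r : ℝ) * t + 1) * ∏ l ∈ Finset.Icc (r + 1) (s - 1), ((l : ℝ) * t + 1) := by
    rw [Finset.Icc_add_one_left_eq_Ioc, ← Finset.mul_prod_Ioc_eq_prod_Icc (by omega)]
  obtain ⟨p, hp⟩ : ∃ p, s - 1 - r = p + 1 := ⟨s - 2 - r, by omega⟩
  obtain ⟨q, rfl⟩ := Nat.exists_eq_add_of_le' hr.1
  rw [gammaTerm, gammaTerm, hprod, hp, show s - 1 - (q + 1 + 1) = p by omega,
    Nat.factorial_succ, Nat.add_sub_cancel, Nat.add_sub_cancel, pow_succ]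
  have := Nat.factorial_ne_zero p
  push_cast
  field_simp

theorem gammaTerm_pos (ht : 1 ≤ t) (r : ℕ) : 0 < gammaTerm s t r := by
  have : (0 : ℝ) < t := by exact_mod_cast ht
  exact mul_pos (by positivity) (Finset.prod_pos fun l _ => by positivity)

theorem gamma_eq_sum : gamma s t = ∑ r ∈ Finset.Icc 1 (s - 1), gammaTerm s t r := rfl

theorem _root_.Finset.sum_Ioc_one_eq {M : Type*} [AddCommMonoid M] [IsCancelAdd M] (f : ℕ → M)
    (hs : 1 ≤ s) : ∑ r ∈ Finset.Ioc 1 s, f r = ∑ r ∈ Finset.Icc 1 (s - 1), f (r + 1) := by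
  rw [← add_right_inj (f 1), Finset.add_sum_Ioc_eq_sum_Icc hs, Finset.sum_Icc_one_eq_add f hs]

/-- The right-hand side mirrors the count of servers with a given part as a singleton: Type `T_1`
gives the first term, Type `T_{r+1}` the `r`-th summand. -/
theorem beta_eq_sum (hs : 1 < s) :
    beta s t = gammaTerm s t 1 / (s - 1) +
      ∑ r ∈ Finset.Icc 1 (s - 1), gammaTerm s t r * (t - 1) / (r * t + 1) := by
  have hs0 : (s : ℝ) - 1 ≠ 0 := by
    have : (1 : ℝ) < s := by exact_mod_cast hs
    linarith
  rw [beta, ← one_add_one_eq_two, Finset.Icc_add_one_left_eq_Ioc 1 s, Finset.sum_Ioc_one_eq _ hs.le,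
    Finset.mul_sum]
  congr 1
  · obtain ⟨q, rfl⟩ := Nat.exists_eq_add_of_le' hs
    have := Nat.factorial_ne_zero q
    rw [gammaTerm, show q + 1 + 1 - 1 - 1 = q by omega, show q + 1 + 1 - 1 = q + 1 by omega,
      Nat.factorial_succ]
    generalize ∏ l ∈ Finset.Icc 1 (q + 1), ((l : ℝ) * t + 1) = P
    push_cast at hs0 ⊢
    have h2 : (q : ℝ) + 1 + 1 - 1 = q + 1 := by ring
    have h3 : (q : ℝ) + 1 ≠ 0 := by positivity
    simp only [Nat.succ_eq_add_one] at *
    field_simp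
    ring
  · refine Finset.sum_congr rfl fun r hr => ?_
    rw [Finset.mem_Icc] at hr
    have h0 : (r : ℝ) * t + 1 ≠ 0 := by positivity
    rw [gammaTerm, Finset.Icc_add_one_left_eq_Ioc, ← Finset.mul_prod_Ioc_eq_prod_Icc hr.2,
      show s - (r + 1) = s - 1 - r by omega, show r + 1 - (1 + 1) = r - 1 by omega]
    field_simp

/-- The counts of servers are proportional to the summands of `gamma`. -/
theorem Admissible.avoidCount_mul (ht : 1 ≤ t) (h : Admissible s t η)
    (hr : r ∈ Finset.Icc 1 (s - 1)) :
    (avoidCount s t η r : ℝ) = avoidCount s t η 1 / gammaTerm s t 1 * gammaTerm s t r := by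
  rw [Finset.mem_Icc] at hr
  obtain ⟨h1, h2⟩ := hr
  induction r, h1 using Nat.le_induction with
  | base => rw [div_mul_cancel₀ _ (gammaTerm_pos ht 1).ne']
  | succ q hq ih =>
    have e1 := gammaTerm_succ_mul (s := s) (t := t) (r := q) (Finset.mem_Icc.2 ⟨hq, by omega⟩)
    have e2 := h.avoidCount_succ_mul ht (r := q) (Finset.mem_Icc.2 ⟨hq, by omega⟩)
    have e3 : (avoidCount s t η (q + 1) : ℝ) * (q * t + 1) =
      avoidCount s t η q * ((s - 1 - q : ℕ) * t) := by exact_mod_cast e2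
    have h0 : (0 : ℝ) < q * t + 1 := by positivity
    refine mul_right_cancel₀ h0.ne' ?_
    rw [e3, mul_assoc, e1, ih (by omega)]
    ring

/-- The number of servers with a given part as a singleton and the number of servers avoiding it
have the ratio `beta / gamma`. -/
theorem Admissible.exists_card_eq_mul (hs : 1 < s) (ht : 2 ≤ t) (h : Admissible s t η) :
    ∃ κ : ℝ, 0 < κ ∧ ∀ i : Fin (s * t),
      (Nat.card {v : Server s t η // i ∈ v.singles} : ℝ) = κ * beta s t ∧
      (Nat.card {v : Server s t η // i ∉ v.singles ∧ i ∉ v.sumParts} : ℝ) = κ * gamma s t := by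
  have ht1 : 1 ≤ t := by omega
  refine ⟨avoidCount s t η 1 / gammaTerm s t 1,
    div_pos (by exact_mod_cast h.avoidCount_one_pos hs) (gammaTerm_pos ht1 1), fun i => ⟨?_, ?_⟩⟩
  · rw [card_mem_singles hs.le ht i, beta_eq_sum hs, mul_add, Finset.mul_sum, Nat.cast_add,
      Nat.cast_sum]
    have hs0 : (0 : ℝ) < s - 1 := by
      have : (1 : ℝ) < s := by exact_mod_cast hs
      linarith
    congr 1
    · have h1 : η 1 * (s * t - 1).choose (t - 1) * (s - 1) = avoidCount s t η 1 := by
        rw [avoidCount, one_mul, mul_assoc, choose_pred_mul ht1, splitCount, if_pos rfl, mul_one]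
      have h2 : ((η 1 * (s * t - 1).choose (t - 1) : ℕ) : ℝ) * (s - 1) = avoidCount s t η 1 := by
        rw [← h1, Nat.cast_mul (_ * _), Nat.cast_sub hs.le, Nat.cast_one]
      rw [div_mul_div_cancel₀ (gammaTerm_pos ht1 1).ne', eq_div_iff hs0.ne', h2]
    · refine Finset.sum_congr rfl fun r hr => ?_
      have h1 := h.singleCount_mul ht hr
      have h2 : (singleCount s t η r : ℝ) * (r * t + 1) = avoidCount s t η r * (t - 1) := by
        have := congrArg (Nat.cast : ℕ → ℝ) h1
        rw [Nat.cast_mul, Nat.cast_mul, Nat.cast_sub ht1] at this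
        exact_mod_cast this
      have h0 : (0 : ℝ) < r * t + 1 := by positivity
      change (singleCount s t η r : ℝ) = _
      rw [← mul_div_assoc, eq_div_iff h0.ne', h2, h.avoidCount_mul ht1 hr]
      ring
  · rw [card_notMem_parts hs.le ht1 i, gamma_eq_sum, Finset.mul_sum, Nat.cast_sum]
    exact Finset.sum_congr rfl fun r hr => h.avoidCount_mul ht1 hr

end GeneralConstruction

/-! ### Separating functionals and injections from fiber sizes -/

namespace ArrayCode

variable {F : Type*} [Field F] {t : ℕ} {M : Type*} {p : ℕ}

theorem notMem_columnSpan_of_forall (A : ArrayCode F t M p) {S : Set M} {y : Fin p → F}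
    (φ : (Fin p → F) →ₗ[F] F) (h : ∀ v ∈ S, ∀ c, φ (A c v) = 0) (hy : φ y ≠ 0) :
    y ∉ A.columnSpan S := by
  intro hmem
  have : A.columnSpan S ≤ LinearMap.ker φ := by
    refine Submodule.span_le.2 ?_
    rintro _ ⟨v, hv, c, rfl⟩
    exact h v hv c
  exact hy (this hmem)

theorem HasPIRRate.unique [Fintype M] {A : ArrayCode F t M p} {ρ ρ' : ℝ} (h : A.HasPIRRate ρ)
    (h' : A.HasPIRRate ρ') : ρ = ρ' := by
  obtain ⟨k, hk, rfl⟩ := h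
  obtain ⟨k', hk', rfl⟩ := h'
  rw [hk.unique hk']

end ArrayCode

/-- Maps between finite types such that the fibers of `g` are as large as those of `h` over each
value of `g`, lift to an injection. -/
theorem exists_injective_of_card_fiber_eq {X Y Z : Type*} [Finite X] [Finite Y] (g : X → Z)
    (h : Y → Z) (H : ∀ x, Nat.card {x' // g x' = g x} = Nat.card {y // h y = g x}) :
    ∃ f : X → Y, Function.Injective f ∧ ∀ x, h (f x) = g x := by
  have e (z : Set.range g) : Nonempty ({x' // g x' = z} ≃ {y // h y = z}) := by
    obtain ⟨_, x, rfl⟩ := z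
    exact Finite.card_eq.1 (H x)
  -- One bijection is chosen per value of `g`, so points of the same fiber share it; this is what
  -- gives injectivity.
  replace e (z : Set.range g) := (e z).some
  refine ⟨fun x => (e ⟨g x, x, rfl⟩ ⟨x, rfl⟩).1, fun x x' hxx => ?_,
    fun x => (e ⟨g x, x, rfl⟩ ⟨x, rfl⟩).2⟩
  have key (z : Set.range g) (x : X) (hx : g x = z) (x' : X) (hx' : g x' = z)
      (hf : (e z ⟨x, hx⟩).1 = (e z ⟨x', hx'⟩).1) : x = x' :=
    congrArg Subtype.val ((e z).injective (Subtype.ext hf))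
  have hg : g x = g x' := by
    have h1 := (e ⟨g x, x, rfl⟩ ⟨x, rfl⟩).2
    have h2 := (e ⟨g x', x', rfl⟩ ⟨x', rfl⟩).2
    simp only at hxx h1 h2
    rw [← h1, ← h2, hxx]
  have aux (z : Set.range g) (hz : (⟨g x', x', rfl⟩ : Set.range g) = z) (hz' : g x' = z) :
      (e ⟨g x', x', rfl⟩ ⟨x', rfl⟩).1 = (e z ⟨x', hz'⟩).1 := by
    subst hz
    rfl
  refine key ⟨g x, x, rfl⟩ x rfl x' hg.symm ?_
  rw [← aux ⟨g x, x, rfl⟩ (Subtype.ext hg.symm) hg.symm]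
  exact hxx

/-! ### Recovery sets and the PIR rate -/

namespace GeneralConstruction

variable {F : Type*} [Field F] {s t : ℕ} {η : ℕ → ℕ}

/-- The servers avoiding a part are matched with the servers having it in the sum. -/
theorem Admissible.exists_matching (ht : 1 ≤ t) (h : Admissible s t η) (i : Fin (s * t)) :
    ∃ f : {v : Server s t η // i ∉ v.parts} → Server s t η, Function.Injective f ∧
      ∀ v, i ∈ (f v).sumParts ∧ (f v).sumParts.erase i = v.1.parts := by
  -- Both kinds of server are sorted by the set of parts that defines adjacency; equal fibers
  -- replace an appeal to Hall's theorem.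
  obtain ⟨f, hf, hf'⟩ := exists_injective_of_card_fiber_eq
    (fun v : {v : Server s t η // i ∉ v.parts} => v.1.parts)
    (fun u : {u : Server s t η // i ∈ u.sumParts} => u.1.sumParts.erase i) fun v => by
      have h1 := v.1.type_lt_of_notMem_parts ht v.2
      have h2 := v.1.one_le_type
      have hr : v.1.type ∈ Finset.Icc 1 (s - 1) := Finset.mem_Icc.2 ⟨h2, by omega⟩
      have hW : (insert i v.1.parts).card = v.1.type * t + 1 := by
        rw [Finset.card_insert_of_notMem v.2, v.1.card_parts ht]
      have e1 : {v' : {v : Server s t η // i ∉ v.parts} // v'.1.parts = v.1.parts} ≃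
          {v' : Server s t η // v'.parts = v.1.parts} :=
        Equiv.subtypeSubtypeEquivSubtype (p := fun v' : Server s t η => i ∉ v'.parts)
          fun {v'} (hv' : v'.parts = v.1.parts) => by rw [hv']; exact v.2
      have e2 : {u : {u : Server s t η // i ∈ u.sumParts} // u.1.sumParts.erase i = v.1.parts} ≃
          {u : Server s t η // u.sumParts = insert i v.1.parts} :=
        (Equiv.subtypeSubtypeEquivSubtypeInter (fun u : Server s t η => i ∈ u.sumParts)
          fun u => u.sumParts.erase i = v.1.parts).trans <| Equiv.subtypeEquivRight fun u => by
            constructor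
            · rintro ⟨hu, hu'⟩
              rw [← hu', Finset.insert_erase hu]
            · intro hu
              rw [hu]
              exact ⟨Finset.mem_insert_self _ _, Finset.erase_insert v.2⟩
      rw [Nat.card_congr e1, Nat.card_congr e2,
        Server.card_parts_eq ht v.1.type_mem (v.1.card_parts ht),
        Server.card_sumParts_eq ht hr hW, ((admissible_iff ht).1 h).2 _ hr]
  exact ⟨fun v => (f v).1, Subtype.val_injective.comp hf, fun v => ⟨(f v).2, hf' v⟩⟩

theorem code_mem (v : Server s t η) (c : Fin t) :
    (∃ a ∈ v.singles, code F s t η c v = Pi.single a 1) ∨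
      code F s t η c v = ∑ b ∈ v.sumParts, Pi.single b 1 := by
  unfold code
  split_ifs with h
  · exact Or.inl ⟨_, Finset.orderEmbOfFin_mem _ _ _, rfl⟩
  · exact Or.inr rfl

theorem Server.card_singles_le (ht : 1 ≤ t) (v : Server s t η) :
    v.singles.card ≤ t ∧ (v.sumParts.Nonempty → v.singles.card < t) := by
  have hv := v.isContent
  have h1 := v.one_le_type
  by_cases h2 : v.type = 1
  · rw [h2, isContent_one] at hv
    exact ⟨hv.1.le, fun h => absurd hv.2 h.ne_empty⟩
  · rw [IsContent, if_neg h2] at hv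
    have h3 : v.singles.card = t - 1 := hv.2.1
    exact ⟨by omega, fun _ => by omega⟩

theorem single_mem_columnSpan (ht : 1 ≤ t) {v : Server s t η} {S : Set (Server s t η)}
    (hv : v ∈ S) {a : Fin (s * t)} (ha : a ∈ v.singles) :
    (Pi.single a 1 : Fin (s * t) → F) ∈ (code F s t η).columnSpan S := by
  obtain ⟨j, hj⟩ : ∃ j, v.singles.orderEmbOfFin rfl j = a := by
    have := Finset.range_orderEmbOfFin v.singles rfl
    exact (this ▸ ha : a ∈ Set.range (v.singles.orderEmbOfFin rfl))
  refine Submodule.subset_span ⟨v, hv, ⟨j, j.2.trans_le (v.card_singles_le ht).1⟩, ?_⟩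
  rw [code, dif_pos j.2, ← hj]

theorem sum_mem_columnSpan (ht : 1 ≤ t) {v : Server s t η} {S : Set (Server s t η)}
    (hv : v ∈ S) :
    ∑ b ∈ v.sumParts, (Pi.single b 1 : Fin (s * t) → F) ∈ (code F s t η).columnSpan S := by
  rcases v.sumParts.eq_empty_or_nonempty with h | h
  · rw [h, Finset.sum_empty]
    exact zero_mem _
  · refine Submodule.subset_span ⟨v, hv, ⟨v.singles.card, (v.card_singles_le ht).2 h⟩, ?_⟩
    rw [code, dif_neg (lt_irrefl _)]

/-- Subtracting all parts of `v`, its sum taken as a whole, from the sum of `u` leaves `x_i`. -/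
theorem single_mem_columnSpan_of_erase (ht : 1 ≤ t) {u v : Server s t η}
    {S : Set (Server s t η)} (hu : u ∈ S) (hv : v ∈ S) {i : Fin (s * t)} (hi : i ∈ u.sumParts)
    (huv : u.sumParts.erase i = v.parts) :
    (Pi.single i 1 : Fin (s * t) → F) ∈ (code F s t η).columnSpan S := by
  have h1 : (Pi.single i 1 : Fin (s * t) → F) = ∑ b ∈ u.sumParts, Pi.single b 1 -
      (∑ b ∈ v.singles, Pi.single b 1 + ∑ b ∈ v.sumParts, Pi.single b 1) := by
    rw [← Finset.sum_union v.disjoint, ← Server.parts, ← huv, ← Finset.add_sum_erase _ _ hi,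
      add_sub_cancel_right]
  rw [h1]
  exact sub_mem (sum_mem_columnSpan ht hu)
    (add_mem (sum_mem fun b hb => single_mem_columnSpan ht hv hb) (sum_mem_columnSpan ht hv))

/-- A single server does not determine a part that it does not have as a singleton. -/
theorem single_notMem_columnSpan (ht : 1 ≤ t) {v : Server s t η} {i : Fin (s * t)}
    (hi : i ∉ v.singles) {S : Set (Server s t η)} (hS : S ⊆ {v}) :
    (Pi.single i 1 : Fin (s * t) → F) ∉ (code F s t η).columnSpan S := by
  by_cases hB : i ∈ v.sumParts
  · obtain ⟨h2, h3⟩ := v.card_sumParts ⟨i, hB⟩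
    have h4 : 1 < v.sumParts.card := by
      have := Nat.mul_pos (show 0 < v.type - 1 by omega) ht
      omega
    obtain ⟨j, hj, hji⟩ := Finset.exists_mem_ne h4 i
    have hjA : j ∉ v.singles := Finset.disjoint_right.1 v.disjoint hj
    -- The difference of coordinates `i` and `j` vanishes on the sum, which contains both, and on
    -- every singleton of the server, but not on `x_i`.
    refine ArrayCode.notMem_columnSpan_of_forall _
      (LinearMap.proj (R := F) (φ := fun _ => F) i - LinearMap.proj j) ?_ ?_
    · intro w hw c
      obtain rfl := hS hw
      rcases code_mem (F := F) w c with ⟨a, ha, h⟩ | h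
      · have hia : i ≠ a := fun h => hi (h ▸ ha)
        have hja : j ≠ a := fun h => hjA (h ▸ ha)
        simp [h, hia, hja]
      · simp [h, Pi.single_apply, hj, hB]
    · simp [hji]
  · refine ArrayCode.notMem_columnSpan_of_forall _ (LinearMap.proj (R := F) (φ := fun _ => F) i) ?_ ?_
    · intro w hw c
      obtain rfl := hS hw
      rcases code_mem (F := F) w c with ⟨a, ha, h⟩ | h
      · have hia : i ≠ a := fun h => hi (h ▸ ha)
        simp [h, hia]
      · simp [h, Pi.single_apply, hB]
    · simp

theorem card_server_eq_add (i : Fin (s * t)) :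
    Fintype.card (Server s t η) = Nat.card {v : Server s t η // i ∈ v.singles} +
      Nat.card {v : Server s t η // i ∉ v.singles ∧ i ∉ v.sumParts} +
      Nat.card {v : Server s t η // i ∈ v.sumParts} := by
  classical
  have hd (v : Server s t η) (h : i ∈ v.sumParts) : i ∉ v.singles :=
    Finset.disjoint_right.1 v.disjoint h
  simp only [Nat.card_eq_fintype_card, Fintype.card_subtype]
  rw [← Finset.card_union_of_disjoint, ← Finset.card_union_of_disjoint, ← Finset.card_univ]
  · congr 1
    ext v
    simp only [Finset.mem_univ, Finset.mem_union, Finset.mem_filter, true_and]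
    tauto
  · rw [← Finset.filter_or, Finset.disjoint_filter]
    intro v _
    have := hd v
    tauto
  · rw [Finset.disjoint_filter]
    tauto

theorem Admissible.card_mem_sumParts (hs : 1 ≤ s) (ht : 1 ≤ t) (h : Admissible s t η)
    (i : Fin (s * t)) :
    Nat.card {v : Server s t η // i ∈ v.sumParts} =
      Nat.card {v : Server s t η // i ∉ v.singles ∧ i ∉ v.sumParts} := by
  rw [GeneralConstruction.card_mem_sumParts hs, card_notMem_parts hs ht]
  exact Finset.sum_congr rfl fun r hr => (h.avoidCount_eq ht hr).symm

/-- Servers having a part as a singleton count twice in a packing of recovery sets. -/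
theorem two_mul_le_of_recovery (ht : 1 ≤ t) {k : ℕ} {i : Fin (s * t)}
    (S : Fin k → Set (Server s t η)) (hS : ∀ a b, a ≠ b → Disjoint (S a) (S b))
    (hi : ∀ a, (Pi.single i 1 : Fin (s * t) → F) ∈ (code F s t η).columnSpan (S a)) :
    2 * k ≤ Fintype.card (Server s t η) + Nat.card {v : Server s t η // i ∈ v.singles} := by
  classical
  -- With these weights every recovery set weighs at least 2.
  let w : Server s t η → ℕ := fun v => 1 + if i ∈ v.singles then 1 else 0
  have hw : ∑ v, w v =
      Fintype.card (Server s t η) + Nat.card {v : Server s t η // i ∈ v.singles} := by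
    rw [Finset.sum_add_distrib, Finset.sum_boole, Nat.card_eq_fintype_card, Fintype.card_subtype]
    simp
  have h2 (a : Fin k) : 2 ≤ ∑ v ∈ (S a).toFinset, w v := by
    by_contra! hlt
    by_cases hA : ∃ v ∈ S a, i ∈ v.singles
    · obtain ⟨v, hv, hiv⟩ := hA
      have := Finset.single_le_sum (f := w) (fun _ _ => Nat.zero_le _) (Set.mem_toFinset.2 hv)
      simp only [w, if_pos hiv] at this hlt
      omega
    · push Not at hA
      have hcard : (S a).toFinset.card ≤ 1 := by
        rw [Finset.card_eq_sum_ones]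
        exact (Finset.sum_le_sum fun v _ => Nat.le_add_right 1 _).trans (Nat.le_of_lt_succ hlt)
      rcases (S a).eq_empty_or_nonempty with he | ⟨v, hv⟩
      · have := hi a
        rw [he] at this
        simp [ArrayCode.columnSpan] at this
      · refine single_notMem_columnSpan ht (hA v hv) (fun u hu => ?_) (hi a)
        exact Finset.card_le_one.1 hcard _ (Set.mem_toFinset.2 hu) _ (Set.mem_toFinset.2 hv)
  calc 2 * k = ∑ a : Fin k, 2 := by simp [mul_comm]
    _ ≤ ∑ a, ∑ v ∈ (S a).toFinset, w v := Finset.sum_le_sum fun a _ => h2 a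
    _ = ∑ v ∈ Finset.univ.biUnion fun a => (S a).toFinset, w v := by
        rw [Finset.sum_biUnion]
        intro a _ b _ hab
        exact Set.disjoint_toFinset.2 (hS a b hab)
    _ ≤ ∑ v, w v := Finset.sum_le_sum_of_subset (Finset.subset_univ _)
    _ = _ := hw

theorem Admissible.exists_recovery (ht : 1 ≤ t) (h : Admissible s t η) (i : Fin (s * t)) {k : ℕ}
    (hk : k = Nat.card {v : Server s t η // i ∈ v.singles} +
      Nat.card {v : Server s t η // i ∉ v.singles ∧ i ∉ v.sumParts}) :
    ∃ S : Fin k → Set (Server s t η), (∀ a b, a ≠ b → Disjoint (S a) (S b)) ∧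
      ∀ a, (Pi.single i 1 : Fin (s * t) → F) ∈ (code F s t η).columnSpan (S a) := by
  obtain ⟨f, hf, hf'⟩ := h.exists_matching ht i
  -- Servers with the singleton recover alone; each server avoiding the part is paired with its
  -- match.
  let R : {v : Server s t η // i ∈ v.singles} ⊕ {v : Server s t η // i ∉ v.parts} →
      Set (Server s t η) := Sum.elim (fun v => {v.1}) fun v => {v.1, f v}
  have hR : ∀ a b, a ≠ b → Disjoint (R a) (R b) := by
    have hd (v : Server s t η) (h : i ∈ v.sumParts) : i ∉ v.singles :=
      Finset.disjoint_right.1 v.disjoint h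
    have h1 (v : {v : Server s t η // i ∉ v.parts}) := Server.notMem_parts.1 v.2
    have h3 (v : {v : Server s t η // i ∈ v.singles}) (u : {v : Server s t η // i ∉ v.parts}) :
        v.1 ≠ u.1 ∧ v.1 ≠ f u :=
      ⟨fun e => (h1 u).1 (e ▸ v.2), fun e => hd _ (hf' u).1 (e ▸ v.2)⟩
    have h4 (v u : {v : Server s t η // i ∉ v.parts}) : v.1 ≠ f u :=
      fun e => (h1 v).2 (e ▸ (hf' u).1)
    rintro (a | a) (b | b) hab
    · simpa [R, Subtype.ext_iff] using fun e => hab (congrArg _ (Subtype.ext e))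
    · simpa [R] using h3 a b
    · simpa [R] using h3 b a
    · have hab' : a ≠ b := fun e => hab (congrArg _ e)
      have h5 : a.1 ≠ b.1 := fun e => hab' (Subtype.ext e)
      have h6 : f a ≠ f b := fun e => hab' (hf e)
      simp [R, h5.symm, h6.symm, h4 b a, (h4 a b).symm]
  have hcard : Nat.card ({v : Server s t η // i ∈ v.singles} ⊕
      {v : Server s t η // i ∉ v.parts}) = k := by
    rw [Nat.card_sum, hk, Nat.card_congr (Equiv.subtypeEquivRight fun v => Server.notMem_parts)]
  let e := (Finite.equivFinOfCardEq hcard).symm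
  have hspan (x) : (Pi.single i 1 : Fin (s * t) → F) ∈ (code F s t η).columnSpan (R x) := by
    rcases x with v | v
    · have hv : v.1 ∈ R (Sum.inl v) := rfl
      exact single_mem_columnSpan ht hv v.2
    · have hv : v.1 ∈ R (Sum.inr v) := Or.inl rfl
      have hu : f v ∈ R (Sum.inr v) := Or.inr rfl
      exact single_mem_columnSpan_of_erase ht hu hv (hf' v).1 (hf' v).2
  exact ⟨fun a => R (e a), fun a b hab => hR _ _ (e.injective.ne hab), fun a => hspan (e a)⟩

theorem Admissible.hasPIRRate (hs : 1 < s) (ht : 1 < t) (h : Admissible s t η) :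
    (code F s t η).HasPIRRate ((beta s t + gamma s t) / (beta s t + 2 * gamma s t)) := by
  obtain ⟨κ, hκ, hcount⟩ := h.exists_card_eq_mul hs ht
  have ht1 : 1 ≤ t := ht.le
  -- The value of `k` is computed at one part; it serves all parts because the counts `κ * beta` and
  -- `κ * gamma` do not depend on the part.
  let i₀ : Fin (s * t) := ⟨0, Nat.mul_pos (by omega) ht1⟩
  have h0 := hcount i₀
  have hm (i) := card_server_eq_add (η := η) (s := s) (t := t) i
  simp only [h.card_mem_sumParts hs.le ht1] at hm
  refine ⟨Nat.card {v : Server s t η // i₀ ∈ v.singles} +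
    Nat.card {v : Server s t η // i₀ ∉ v.singles ∧ i₀ ∉ v.sumParts}, ⟨fun i => ?_, ?_⟩, ?_⟩
  · refine h.exists_recovery ht1 i ?_
    congr 1
    · exact_mod_cast h0.1.trans (hcount i).1.symm
    · exact_mod_cast h0.2.trans (hcount i).2.symm
  · intro k hk
    obtain ⟨S, hS, hi⟩ := hk i₀
    have := two_mul_le_of_recovery ht1 S hS hi
    have := hm i₀
    omega
  · rw [hm i₀]
    push_cast
    rw [h0.1, h0.2, ← mul_add, ← mul_add, mul_div_mul_left _ _ hκ.ne', add_assoc, ← two_mul]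

end GeneralConstruction

/-! ### The limit for fixed `s` -/

namespace GeneralConstruction

variable {s r : ℕ}

theorem factorial_mul_prod_Icc {N : ℕ} (h : r ≤ N) :
    (r.factorial : ℝ) * ∏ l ∈ Finset.Icc (r + 1) N, (l : ℝ) = N.factorial := by
  induction N, h using Nat.le_induction with
  | base => simp
  | succ n hn ih =>
    rw [Finset.prod_Icc_succ_top (by omega), ← mul_assoc, ih, Nat.factorial_succ, mul_comm]
    push_cast
    rfl

/-- Each of the `q + 1 - r` linear factors absorbs one power of `t`, and the product tends to
`(q+1)!/r!`. Here `s = q + 2` and the index is shifted to `r + 1`, which keeps natural subtraction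
harmless. -/
theorem tendsto_gammaTerm {q : ℕ} (hr : r ≤ q) :
    Tendsto (fun t : ℕ => gammaTerm (q + 2) t (r + 1) / (t : ℝ) ^ (q + 1)) atTop
      (𝓝 ((q + 1).factorial * ((q + 1) * q.choose r))) := by
  have hlim : Tendsto (fun t : ℕ => ((q + 1).factorial : ℝ) / ((q - r).factorial : ℝ) *
      ∏ l ∈ Finset.Icc (r + 1) (q + 1), ((l : ℝ) + 1 / (t : ℝ))) atTop
      (𝓝 (((q + 1).factorial : ℝ) / ((q - r).factorial : ℝ) *
        ∏ l ∈ Finset.Icc (r + 1) (q + 1), ((l : ℝ) + 0))) :=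
    (tendsto_finsetProd _ fun l _ => tendsto_one_div_atTop_nhds_zero_nat.const_add _).const_mul _
  have hval : ((q + 1).factorial : ℝ) / ((q - r).factorial : ℝ) *
      ∏ l ∈ Finset.Icc (r + 1) (q + 1), ((l : ℝ) + 0) =
      (q + 1).factorial * ((q + 1) * q.choose r) := by
    have h1 := factorial_mul_prod_Icc (show r ≤ q + 1 by omega)
    have h2 := Nat.factorial_ne_zero r
    have h3 := Nat.factorial_ne_zero (q - r)
    simp only [add_zero]
    rw [Nat.cast_choose ℝ hr]
    rw [show ∏ l ∈ Finset.Icc (r + 1) (q + 1), (l : ℝ) = (q + 1).factorial / r.factorial by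
      rw [eq_div_iff (by positivity), mul_comm, h1]]
    rw [Nat.factorial_succ]
    push_cast
    field_simp
  rw [← hval]
  refine hlim.congr' ?_
  filter_upwards [eventually_ge_atTop 1] with t ht
  have ht0 : (t : ℝ) ≠ 0 := by positivity
  have hprod : ∏ l ∈ Finset.Icc (r + 1) (q + 1), ((l : ℝ) + 1 / (t : ℝ)) =
      (∏ l ∈ Finset.Icc (r + 1) (q + 1), ((l : ℝ) * t + 1)) / (t : ℝ) ^ (q + 1 - r) := by
    rw [show q + 1 - r = (Finset.Icc (r + 1) (q + 1)).card by rw [Nat.card_Icc]; omega,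
      ← Finset.prod_const, ← Finset.prod_div_distrib]
    refine Finset.prod_congr rfl fun l _ => ?_
    field_simp
  have hpow : (t : ℝ) ^ (q + 1) = (t : ℝ) ^ r * (t : ℝ) ^ (q + 1 - r) := by
    rw [← pow_add]
    congr 1
    omega
  rw [hprod, gammaTerm, hpow, show q + 2 - 1 = q + 1 by omega,
    show q + 1 - (r + 1) = q - r by omega, Nat.add_sub_cancel]
  generalize ∏ l ∈ Finset.Icc (r + 1) (q + 1), ((l : ℝ) * t + 1) = P
  field_simp

theorem sum_Icc_one_eq_sum_range (f : ℕ → ℝ) (q : ℕ) :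
    ∑ r ∈ Finset.Icc 1 (q + 1), f r = ∑ r ∈ Finset.range (q + 1), f (r + 1) := by
  rw [Finset.range_eq_Ico, Finset.sum_Ico_add' f 0 (q + 1) 1]
  rfl

theorem tendsto_gamma (q : ℕ) :
    Tendsto (fun t : ℕ => gamma (q + 2) t / (t : ℝ) ^ (q + 1)) atTop
      (𝓝 ((q + 1).factorial * ((q + 1) * 2 ^ q))) := by
  have h : Tendsto (fun t : ℕ => ∑ r ∈ Finset.range (q + 1),
      gammaTerm (q + 2) t (r + 1) / (t : ℝ) ^ (q + 1)) atTop
      (𝓝 (∑ r ∈ Finset.range (q + 1), ((q + 1).factorial * ((q + 1) * (q.choose r : ℝ))))) :=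
    tendsto_finsetSum _ fun r hr => tendsto_gammaTerm (Nat.lt_succ_iff.1 (Finset.mem_range.1 hr))
  rw [← Finset.mul_sum, ← Finset.mul_sum, ← Nat.cast_sum, Nat.sum_range_choose,
    Nat.cast_pow, Nat.cast_ofNat] at h
  refine h.congr fun t => ?_
  rw [gamma_eq_sum, ← Finset.sum_div, show q + 2 - 1 = q + 1 by omega,
    sum_Icc_one_eq_sum_range]

theorem tendsto_beta (q : ℕ) :
    Tendsto (fun t : ℕ => beta (q + 2) t / (t : ℝ) ^ (q + 1)) atTop
      (𝓝 ((q + 1).factorial * 2 ^ (q + 1))) := by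
  have hfrac (r : ℕ) : Tendsto (fun t : ℕ => ((t : ℝ) - 1) / ((r + 1 : ℕ) * t + 1)) atTop
      (𝓝 (1 / (r + 1))) := by
    have h1 : Tendsto (fun t : ℕ => (1 - 1 / (t : ℝ)) / (((r + 1 : ℕ) : ℝ) + 1 / (t : ℝ))) atTop
        (𝓝 ((1 - 0) / (((r + 1 : ℕ) : ℝ) + 0))) :=
      (tendsto_one_div_atTop_nhds_zero_nat.const_sub _).div
        (tendsto_one_div_atTop_nhds_zero_nat.const_add _) (by positivity)
    rw [sub_zero, add_zero, Nat.cast_succ] at h1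
    refine h1.congr' ?_
    filter_upwards [eventually_ge_atTop 1] with t ht
    have ht0 : (t : ℝ) ≠ 0 := by positivity
    push_cast
    field_simp
  have h : Tendsto (fun t : ℕ => gammaTerm (q + 2) t (0 + 1) / (t : ℝ) ^ (q + 1) * (1 / (q + 1)) +
      ∑ r ∈ Finset.range (q + 1), gammaTerm (q + 2) t (r + 1) / (t : ℝ) ^ (q + 1) *
        (((t : ℝ) - 1) / ((r + 1 : ℕ) * t + 1))) atTop
      (𝓝 ((q + 1).factorial * ((q + 1) * (q.choose 0 : ℝ)) * (1 / (q + 1)) +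
        ∑ r ∈ Finset.range (q + 1),
          ((q + 1).factorial * ((q + 1) * (q.choose r : ℝ)) * (1 / (r + 1))))) :=
    ((tendsto_gammaTerm (Nat.zero_le q)).mul_const _).add <| tendsto_finsetSum _ fun r hr =>
      (tendsto_gammaTerm (Nat.lt_succ_iff.1 (Finset.mem_range.1 hr))).mul (hfrac r)
  have hval : ((q + 1).factorial * ((q + 1) * (q.choose 0 : ℝ)) * (1 / (q + 1)) +
        ∑ r ∈ Finset.range (q + 1),
          ((q + 1).factorial * ((q + 1) * (q.choose r : ℝ)) * (1 / ((r : ℝ) + 1)))) =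
      (q + 1).factorial * 2 ^ (q + 1) := by
    -- Since `(q+1) * C(q,r) / (r+1) = C(q+1,r+1)`, the sum gives all binomial coefficients of `q +
    -- 1` except `C(q+1,0)`, which the separate first term supplies.
    have h1 : (2 : ℝ) ^ (q + 1) = ∑ r ∈ Finset.range (q + 2), ((q + 1).choose r : ℝ) := by
      rw [← Nat.cast_sum, Nat.sum_range_choose]
      push_cast
      rfl
    have hq : (q : ℝ) + 1 ≠ 0 := by positivity
    rw [h1, Finset.sum_range_succ' _ (q + 1), mul_add, add_comm, Finset.mul_sum]
    congr 1
    · refine Finset.sum_congr rfl fun r _ => ?_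
      have h2 := congrArg (Nat.cast : ℕ → ℝ) (Nat.add_one_mul_choose_eq q r)
      push_cast at h2
      have hr : (r : ℝ) + 1 ≠ 0 := by positivity
      rw [h2]
      field_simp
    · simp only [Nat.choose_zero_right]
      push_cast
      field_simp
  rw [hval] at h
  refine h.congr fun t => ?_
  rw [beta_eq_sum (by omega), show q + 2 - 1 = q + 1 by omega, sum_Icc_one_eq_sum_range, add_div,
    Finset.sum_div]
  congr 1
  · have : ((q + 2 : ℕ) : ℝ) - 1 = q + 1 := by push_cast; ring
    rw [this]
    ring
  · refine Finset.sum_congr rfl fun r _ => ?_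
    ring

theorem tendsto_rate (hs : 1 < s) :
    Tendsto (fun t : ℕ => (beta s t + gamma s t) / (beta s t + 2 * gamma s t)) atTop
      (𝓝 (((s : ℝ) + 1) / (2 * s))) := by
  obtain ⟨q, rfl⟩ := Nat.exists_eq_add_of_le' (show 2 ≤ s from hs)
  have hb := tendsto_beta q
  have hg := tendsto_gamma q
  have hf := Nat.factorial_pos (q + 1)
  have h := (hb.add hg).div (hb.add (hg.const_mul 2)) (by positivity)
  have hval : (((q + 1).factorial : ℝ) * 2 ^ (q + 1) + (q + 1).factorial * ((q + 1) * 2 ^ q)) /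
      ((q + 1).factorial * 2 ^ (q + 1) + 2 * ((q + 1).factorial * ((q + 1) * 2 ^ q))) =
      (((q + 2 : ℕ) : ℝ) + 1) / (2 * (q + 2 : ℕ)) := by
    rw [div_eq_div_iff (by positivity) (by positivity), pow_succ]
    push_cast
    ring
  rw [hval] at h
  refine h.congr' ?_
  filter_upwards [eventually_ge_atTop 1] with t ht
  have ht0 : (t : ℝ) ≠ 0 := by positivity
  simp only [Pi.div_apply]
  rw [← mul_div_assoc, ← add_div, ← add_div, div_div_div_cancel_right₀ (by positivity)]

end GeneralConstruction

theorem mainTheorem5 (F : Type*) [Field F] (s : ℕ) (hs : 1 < s) :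
    (∀ t : ℕ, 1 < t →
      (∃ η : ℕ → ℕ, GeneralConstruction.Admissible s t η) ∧
      ∀ η : ℕ → ℕ, GeneralConstruction.Admissible s t η →
        (GeneralConstruction.code F s t η).HasPIRRate
          ((GeneralConstruction.beta s t + GeneralConstruction.gamma s t) /
            (GeneralConstruction.beta s t + 2 * GeneralConstruction.gamma s t))) ∧
    (∀ ρ : ℕ → ℝ,
      (∀ t : ℕ, 1 < t → ∃ η : ℕ → ℕ, GeneralConstruction.Admissible s t η ∧
        (GeneralConstruction.code F s t η).HasPIRRate (ρ t)) →
      Tendsto ρ atTop (𝓝 (((s : ℝ) + 1) / (2 * (s : ℝ))))) := by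
  refine ⟨fun t ht => ⟨GeneralConstruction.exists_admissible ht.le,
    fun η h => h.hasPIRRate hs ht⟩, fun ρ hρ => ?_⟩
  -- Uniqueness of the rate forces `ρ t` to equal the formula for every `t > 1`, whichever
  -- admissible multiplicities were used.
  refine (GeneralConstruction.tendsto_rate hs).congr' ?_
  filter_upwards [eventually_gt_atTop 1] with t ht
  obtain ⟨η, h, hrate⟩ := hρ t ht
  exact (h.hasPIRRate hs ht).unique hrate
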